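/- Let $p$ be a prime and let $k$ be an algebraically closed field of characteristic $p$. Let $G$ be a finite group, let $B$ be a block of $kG$ with block idempotent $e_B$ (a primitive idempotent of $Z(kG)$), and suppose that $B$ has an abelian defect group $D$; that is, $D$ is abelian and is minimal among the subgroups $H\leq G$ for which $e_B$ is a relative trace $\mathrm{Tr}_H^G(a)=\sum_{gH\in G/H} g a g^{-1}$ of some $a\in kG$ fixed under conjugation by $H$. Let $N\lhd G$, and let $b$ be a block of $kN$ with block idempotent $e_b$ that is $G$-stable (i.e. $g e_b g^{-1}=e_b$ for all $g\in G$) and covered by $B$ (i.e. $e_B e_b\neq 0$). Let $G[b]$ be the subgroup of all $g\in G$ that stabilize $b$ and act on $b=kNe_b$ as an inner automorphism, i.e. for which $ge_bg^{-1}=e_b$ and there is a unit $u$ of the algebra $b$ with $g x g^{-1}=u x u^{-1}$ for all $x\in b$. Then $D\leq G[b]$. -/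

import Mathlib

/-- A block `B` of the group algebra `kG`, given by its block idempotent `e_B`: a primitive
idempotent of the centre of `kG`. The block algebra itself is `GroupBlock.algebra`. -/
structure GroupBlock (k G : Type*) [Field k] [Group G] where
  /-- the block idempotent `e_B` -/
  idem : MonoidAlgebra k G
  central : idem ∈ Subalgebra.center k (MonoidAlgebra k G)
  isIdempotent : IsIdempotentElem idem
  ne_zero : idem ≠ 0
  primitive : ∀ f₁ ∈ Subalgebra.center k (MonoidAlgebra k G),
    ∀ f₂ ∈ Subalgebra.center k (MonoidAlgebra k G),
    IsIdempotentElem f₁ → IsIdempotentElem f₂ → f₁ * f₂ = 0 → f₁ + f₂ = idem → f₁ = 0 ∨ f₂ = 0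

/-- The conjugation action `x ↦ g x g⁻¹` of `g ∈ G` on the group algebra `kN` of a normal
subgroup `N` of `G`. -/
noncomputable def conjGroupAlgebra (k : Type*) {G : Type*} [Field k] [Group G] (N : Subgroup G)
    [N.Normal] (g : G) : MonoidAlgebra k N ≃ₐ[k] MonoidAlgebra k N :=
  MonoidAlgebra.domCongr k k (MulAut.conjNormal g)

theorem conjGroupAlgebra_one (k : Type*) {G : Type*} [Field k] [Group G] (N : Subgroup G)
    [N.Normal] (x : MonoidAlgebra k N) : conjGroupAlgebra k N 1 x = x := by
  simp [conjGroupAlgebra, MulAut.one_def]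

theorem conjGroupAlgebra_mul (k : Type*) {G : Type*} [Field k] [Group G] (N : Subgroup G)
    [N.Normal] (g h : G) (x : MonoidAlgebra k N) :
    conjGroupAlgebra k N (g * h) x = conjGroupAlgebra k N g (conjGroupAlgebra k N h x) := by
  have := congrArg (fun f => f x) (MonoidAlgebra.trans_domCongr_domCongr (R := k) (A := k)
    (MulAut.conjNormal h : N ≃* N) (MulAut.conjNormal g : N ≃* N))
  simp only [AlgEquiv.trans_apply] at this
  simp only [conjGroupAlgebra, map_mul, this]
  rfl

/-- The relative trace `Tr_H^G(a) = ∑_{gH ∈ G/H} g a g⁻¹`, for an element `a` of `kG` that is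
fixed under conjugation by `H` (the choice of coset representatives is then immaterial). -/
noncomputable def relativeTrace (k : Type*) {G : Type*} [Field k] [Group G] (H : Subgroup G)
    (a : MonoidAlgebra k G) : MonoidAlgebra k G :=
  ∑ᶠ q : G ⧸ H, MonoidAlgebra.of k G q.out * a * MonoidAlgebra.of k G q.out⁻¹

namespace GroupBlock

/-- The block algebra `B = kG e_B`, as a subspace of `kG`. -/
noncomputable def algebra {k G : Type*} [Field k] [Group G] (B : GroupBlock k G) :
    Submodule k (MonoidAlgebra k G) :=
  LinearMap.range (LinearMap.mulRight k B.idem)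

/-- `D` is a defect group of `B`: it is minimal, with respect to inclusion, among the subgroups
`H` of `G` such that `e_B` lies in the image `(kG)_H^G` of the relative trace
`Tr_H^G : (kG)^H → Z(kG)`. -/
def IsDefectGroup {k G : Type*} [Field k] [Group G] (B : GroupBlock k G) (D : Subgroup G) : Prop :=
  Minimal (fun H : Subgroup G => ∃ a : MonoidAlgebra k G,
    (∀ h ∈ H, MonoidAlgebra.of k G h * a * MonoidAlgebra.of k G h⁻¹ = a) ∧
      relativeTrace k H a = B.idem) D

/-- The block `B` of `kG` covers the block `b` of `kN`: the product `e_B e_b` in `kG` is not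
zero. -/
def Covers {k G : Type*} [Field k] [Group G] {N : Subgroup G} (B : GroupBlock k G)
    (b : GroupBlock k N) : Prop :=
  B.idem * MonoidAlgebra.mapDomainAlgHom k k N.subtype b.idem ≠ 0

/-- The block `b` of `kN` is `G`-stable: `g e_b g⁻¹ = e_b` for every `g ∈ G`. -/
def IsStable {k G : Type*} [Field k] [Group G] {N : Subgroup G} [N.Normal]
    (b : GroupBlock k N) : Prop :=
  ∀ g : G, conjGroupAlgebra k N g b.idem = b.idem

/-- `g` fixes the block `b` of `kN` and acts on the algebra `b` as an inner automorphism: there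
is a unit `u` of `b`, with inverse `v` in `b` (the identity of `b` being `e_b`), such that
`g x g⁻¹ = u x u⁻¹` for all `x ∈ b`. -/
def ActsAsInner {k G : Type*} [Field k] [Group G] {N : Subgroup G} [N.Normal]
    (b : GroupBlock k N) (g : G) : Prop :=
  conjGroupAlgebra k N g b.idem = b.idem ∧
    ∃ u ∈ b.algebra, ∃ v ∈ b.algebra, u * v = b.idem ∧ v * u = b.idem ∧
      ∀ x ∈ b.algebra, conjGroupAlgebra k N g x = u * x * v

theorem mem_algebra_iff {k G : Type*} [Field k] [Group G] (B : GroupBlock k G)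
    (x : MonoidAlgebra k G) : x ∈ B.algebra ↔ x * B.idem = x := by
  constructor
  · rintro ⟨y, rfl⟩
    simp only [LinearMap.mulRight_apply]
    rw [mul_assoc, B.isIdempotent.eq]
  · exact fun h => ⟨x, h⟩

/-- The subgroup `G[b]` of the elements of `G` that act on the block `b` of `kN` as inner
automorphisms. -/
def innerSubgroup {k G : Type*} [Field k] [Group G] {N : Subgroup G} [N.Normal]
    (b : GroupBlock k N) : Subgroup G where
  carrier := {g | b.ActsAsInner g}
  one_mem' := by
    have he : b.idem ∈ b.algebra := (b.mem_algebra_iff _).2 b.isIdempotent.eq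
    refine ⟨conjGroupAlgebra_one k N _, b.idem, he, b.idem, he, b.isIdempotent.eq,
      b.isIdempotent.eq, fun x hx => ?_⟩
    have hc := Subalgebra.mem_center_iff.1 b.central x
    have hx := (b.mem_algebra_iff x).1 hx
    rw [conjGroupAlgebra_one, ← hc, hx, hx]
  mul_mem' := by
    rintro g h ⟨hg, u, hu, v, hv, huv, hvu, hgx⟩ ⟨hh, u', hu', v', hv', huv', hvu', hhx⟩
    rw [mem_algebra_iff] at hu hv hu' hv'
    have ev : b.idem * v = v := by rw [← Subalgebra.mem_center_iff.1 b.central v, hv]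
    have eu' : b.idem * u' = u' := by rw [← Subalgebra.mem_center_iff.1 b.central u', hu']
    have hm : ∀ x ∈ b.algebra, conjGroupAlgebra k N h x ∈ b.algebra := fun x hx => by
      rw [mem_algebra_iff] at hx ⊢
      nth_rewrite 1 [← hh]
      rw [← map_mul, hx]
    refine ⟨by rw [conjGroupAlgebra_mul, hh, hg], u * u', ?_, v' * v, ?_, ?_, ?_, fun x hx => ?_⟩
    · rw [mem_algebra_iff, mul_assoc, hu']
    · rw [mem_algebra_iff, mul_assoc, hv]
    · rw [mul_assoc, ← mul_assoc u', huv', ev, huv]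
    · rw [mul_assoc, ← mul_assoc v, hvu, eu', hvu']
    · rw [conjGroupAlgebra_mul, hgx _ (hm x hx), hhx x hx]
      simp only [mul_assoc]
  inv_mem' := by
    rintro g ⟨hg, u, hu, v, hv, huv, hvu, hgx⟩
    have hinv : ∀ x, conjGroupAlgebra k N g⁻¹ (conjGroupAlgebra k N g x) = x := fun x => by
      rw [← conjGroupAlgebra_mul, inv_mul_cancel, conjGroupAlgebra_one]
    have hi : conjGroupAlgebra k N g⁻¹ b.idem = b.idem := by
      nth_rewrite 1 [← hg]
      exact hinv _
    refine ⟨hi, v, hv, u, hu, hvu, huv, fun x hx => ?_⟩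
    rw [mem_algebra_iff] at hu hv hx
    have ex : b.idem * x = x := by rw [← Subalgebra.mem_center_iff.1 b.central x, hx]
    have hy : v * x * u ∈ b.algebra := by rw [mem_algebra_iff, mul_assoc, hu]
    have h1 : conjGroupAlgebra k N g (v * x * u) = x := by
      rw [hgx _ hy]
      calc u * (v * x * u) * v = (u * v) * x * (u * v) := by simp only [mul_assoc]
        _ = x := by rw [huv, ex, hx]
    nth_rewrite 1 [← h1]
    exact hinv _

end GroupBlock

/-!
Write `A = kG`, let `e_B`, `e_b` be the two block idempotents and `H = G[b]`, a normal subgroup of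
`G` since `b` is stable. The argument plays two facts about central elements of `A` against each
other.

*Outside `H` everything is nilpotent on `b`* (`GroupBlock.IsStable.isNilpotent_mul_idem`). If
`z ∈ Z(kG)` has no coefficients on `H`, then `z e_b` is nilpotent. Indeed, `z e_b` is the sum of its
components `y_q` in the `G ⧸ N`-grading of `A`. Each `y_q` centralizes `kN`, and a power of it lies
in the local algebra `Z(b)`; if `y_q` were not nilpotent it would be invertible, and an element
`g` in the coset `q` would act on `b` as the inner automorphism given by `g y_q⁻¹`. As `z` is
central, `y_q y_r = y_{qrq⁻¹} y_q`, which makes the sum of the `y_q` nilpotent as well.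

*Multiplying by `x ∈ D` does not matter for the Brauer map*
(`isNilpotent_restrictSupport_relativeTrace_sub`). Let `Br` be the Brauer map of `D`, which forgets
the coefficients outside `C_G(D)` and is multiplicative on the `D`-fixed elements. As `D` is abelian,
`xa` is fixed by `D` whenever `a` is, and `Br (Tr_D^G((1 - x) a))` is a sum over `N_G(D)/D` of
multiples of the elements `1 - gxg⁻¹`, which are nilpotent and commute with all of `kC_G(D)`.

Now let `e_B = Tr_D^G(a)` and suppose that `x ∈ D` is not in `H`. Let `a₀` be the component of `a` in
`kH`, and put `e₀ = Tr_D^G(a₀)`, the component of `e_B` in `kH`, and `z = Tr_D^G(x a₀)`. Both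
`e_B - e₀` and `z` are supported outside `H`, so `e_B = e_B e_b` differs from `(e₀ - z) e_b` by a
nilpotent element; and `Br (e₀ - z)` is nilpotent. Hence the idempotent `Br e_B` is nilpotent, that
is, zero, which contradicts the minimality of the defect group
(`GroupBlock.IsDefectGroup.restrictSupport_idem_ne_zero`).
-/

/-! ### Nilpotent sums -/

theorem isNilpotent_add_commuting_mul {R : Type*} [Ring R] {s r t : R} (hs : IsNilpotent s)
    (ht : IsNilpotent t) (hsr : Commute s r) (hst : Commute s t) : IsNilpotent (t + s * r) := by
  have key : ∀ m : ℕ, ∃ r', Commute s r' ∧ (t + s * r) ^ m = t ^ m + s * r' := by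
    intro m
    induction m with
    | zero => exact ⟨0, Commute.zero_right s, by simp⟩
    | succ m ih =>
      obtain ⟨r', hr', h⟩ := ih
      refine ⟨t ^ m * r + r' * t + r' * (s * r), ?_, ?_⟩
      · exact (((hst.pow_right m).mul_right hsr).add_right (hr'.mul_right hst)).add_right
          (hr'.mul_right ((Commute.refl s).mul_right hsr))
      · have h1 : t ^ m * (s * r) = s * (t ^ m * r) := by
          rw [← mul_assoc, ← (hst.pow_right m).eq, mul_assoc]
        rw [pow_succ, h, add_mul, mul_add, mul_add, h1, pow_succ]
        simp only [mul_add, mul_assoc, add_assoc]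
  obtain ⟨m, hm⟩ := ht
  obtain ⟨n, hn⟩ := hs
  obtain ⟨r', hr', h⟩ := key m
  refine ⟨m * n, ?_⟩
  rw [pow_mul, h, hm, zero_add, hr'.mul_pow, hn, zero_mul]

theorem isNilpotent_sum_commuting_mul {R ι : Type*} [Ring R] (S : Finset ι) (s r : ι → R)
    (hs : ∀ i ∈ S, IsNilpotent (s i)) (hss : ∀ i ∈ S, ∀ j ∈ S, Commute (s i) (s j))
    (hsr : ∀ i ∈ S, ∀ j ∈ S, Commute (s i) (r j)) : IsNilpotent (∑ i ∈ S, s i * r i) := by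
  classical
  induction S using Finset.induction_on with
  | empty => simp
  | insert a S ha ih =>
    rw [Finset.sum_insert ha, add_comm]
    have hm : ∀ j ∈ S, j ∈ insert a S := fun j hj => Finset.mem_insert_of_mem hj
    have h0 := Finset.mem_insert_self a S
    refine isNilpotent_add_commuting_mul (hs _ h0)
      (ih (fun i hi => hs i (hm i hi)) (fun i hi j hj => hss i (hm i hi) j (hm j hj))
        (fun i hi j hj => hsr i (hm i hi) j (hm j hj))) (hsr _ h0 _ h0) ?_
    exact Commute.sum_right _ _ _ fun j hj => (hss _ h0 _ (hm j hj)).mul_right (hsr _ h0 _ (hm j hj))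

/-- The relation `y q * y r = y r' * y q` allows all factors `y q` of a word to be moved to its right
end; the letters that they pass may change, but the word keeps its length. -/
theorem exists_list_map_prod_eq_mul_pow_count {R Q : Type*} [Ring R] [DecidableEq Q] (y : Q → R)
    (htw : ∀ q r, ∃ r', y q * y r = y r' * y q) (q : Q) (l : List Q) :
    ∃ l' : List Q, (l.map y).prod = (l'.map y).prod * y q ^ l.count q := by
  have hmove : ∀ l : List Q, ∃ l' : List Q, y q * (l.map y).prod = (l'.map y).prod * y q := by
    intro l
    induction l with
    | nil => exact ⟨[], by simp⟩
    | cons r t ih =>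
      obtain ⟨l', hl'⟩ := ih
      obtain ⟨r', hr'⟩ := htw q r
      refine ⟨r' :: l', ?_⟩
      rw [List.map_cons, List.prod_cons, List.map_cons, List.prod_cons, ← mul_assoc, hr',
        mul_assoc, hl', mul_assoc]
  induction l with
  | nil => exact ⟨[], by simp⟩
  | cons r t ih =>
    obtain ⟨l', hl'⟩ := ih
    by_cases hr : r = q
    · subst hr
      obtain ⟨l'', hl''⟩ := hmove l'
      refine ⟨l'', ?_⟩
      rw [List.map_cons, List.prod_cons, hl', ← mul_assoc, hl'', List.count_cons_self, pow_succ',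
        mul_assoc]
    · refine ⟨r :: l', ?_⟩
      rw [List.map_cons, List.prod_cons, hl', List.count_cons_of_ne hr, List.map_cons,
        List.prod_cons, mul_assoc]

/-- The elements `y q` need not commute, but in a long word in them some letter `q` occurs often, by
the pigeonhole principle, and its occurrences can be collected into a high power of `y q`. -/
theorem isNilpotent_sum_of_quandle_relation {R Q : Type*} [Ring R] [Fintype Q] (y : Q → R)
    (hy : ∀ q, IsNilpotent (y q)) (htw : ∀ q r, ∃ r', y q * y r = y r' * y q) :
    IsNilpotent (∑ q, y q) := by
  classical
  choose n hn using hy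
  set L := ∑ q, n q with hL
  have hLz : ∀ q, y q ^ L = 0 := fun q =>
    pow_eq_zero_of_le (Finset.single_le_sum (fun i _ => Nat.zero_le (n i)) (Finset.mem_univ q))
      (hn q)
  -- every long word contains some letter at least `L` times
  have hword : ∀ l : List Q, Fintype.card Q * L < l.length → (l.map y).prod = 0 := by
    intro l hl
    have hex : ∃ q, L ≤ l.count q := by
      by_contra! hcon
      have h1 : ∑ q, l.count q = l.length := by
        simpa using Multiset.sum_count_eq_card (s := Finset.univ) (m := (l : Multiset Q)) (by simp)
      have h2 : ∑ q, l.count q ≤ ∑ _q : Q, L := Finset.sum_le_sum fun q _ => (hcon q).le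
      rw [Finset.sum_const, Finset.card_univ, smul_eq_mul] at h2
      omega
    obtain ⟨q, hq⟩ := hex
    obtain ⟨l', hl'⟩ := exists_list_map_prod_eq_mul_pow_count y htw q l
    rw [hl', pow_eq_zero_of_le hq (hLz q), mul_zero]
  have hexp : ∀ m : ℕ, (∑ q, y q) ^ m ∈
      AddSubmonoid.closure {w | ∃ l : List Q, l.length = m ∧ w = (l.map y).prod} := by
    intro m
    induction m with
    | zero => exact AddSubmonoid.subset_closure ⟨[], rfl, by simp⟩
    | succ m ih =>
      rw [pow_succ', Finset.sum_mul]
      refine AddSubmonoid.sum_mem _ fun q _ => ?_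
      generalize (∑ q, y q) ^ m = z at ih
      induction ih using AddSubmonoid.closure_induction with
      | mem w hw =>
        obtain ⟨l, hl, rfl⟩ := hw
        exact AddSubmonoid.subset_closure ⟨q :: l, by simp [hl], by simp⟩
      | zero => rw [mul_zero]; exact AddSubmonoid.zero_mem _
      | add a b _ _ ha hb => rw [mul_add]; exact AddSubmonoid.add_mem _ ha hb
  refine ⟨Fintype.card Q * L + 1, ?_⟩
  have h := hexp (Fintype.card Q * L + 1)
  have hsub : {w | ∃ l : List Q, l.length = Fintype.card Q * L + 1 ∧ w = (l.map y).prod} ⊆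
      ((⊥ : AddSubmonoid R) : Set R) := by
    rintro w ⟨l, hl, rfl⟩
    exact hword l (by omega)
  exact AddSubmonoid.mem_bot.1 (AddSubmonoid.closure_le.2 hsub h)

/-! ### The local algebra of a block -/

namespace GroupBlock

theorem mul_idem_comm {k G : Type*} [Field k] [Group G] (B : GroupBlock k G)
    (x : MonoidAlgebra k G) : x * B.idem = B.idem * x :=
  Subalgebra.mem_center_iff.1 B.central x

theorem idem_eq_or_zero_of_mul_eq {k G : Type*} [Field k] [Group G] (B : GroupBlock k G)
    {f : MonoidAlgebra k G} (hf : f ∈ Subalgebra.center k (MonoidAlgebra k G))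
    (hi : IsIdempotentElem f) (hfe : f * B.idem = f) : f = 0 ∨ f = B.idem := by
  have hef : B.idem * f = f := by rw [← B.mul_idem_comm, hfe]
  have h1 : IsIdempotentElem (B.idem - f) := by
    rw [IsIdempotentElem, mul_sub, sub_mul, sub_mul, B.isIdempotent.eq, hfe, hef, hi.eq, sub_self,
      sub_zero]
  have h2 : f * (B.idem - f) = 0 := by rw [mul_sub, hfe, hi.eq, sub_self]
  exact (B.primitive f hf _ (sub_mem B.central hf) hi h1 h2 (add_sub_cancel f B.idem)).imp_right
    fun h => (sub_eq_zero.1 h).symm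

/-- The algebra `Z(kG) e_B` is local: it is Artinian and `e_B` is its only nonzero idempotent. -/
theorem isNilpotent_or_exists_mul_eq_idem {k G : Type*} [Field k] [Group G] [Finite G]
    (B : GroupBlock k G) {c : MonoidAlgebra k G}
    (hc : c ∈ Subalgebra.center k (MonoidAlgebra k G)) :
    IsNilpotent (c * B.idem) ∨
      ∃ d ∈ Subalgebra.center k (MonoidAlgebra k G), c * d = B.idem ∧ d * B.idem = d := by
  let Z := Subalgebra.center k (MonoidAlgebra k G)
  have : Module.Finite k (MonoidAlgebra k G) :=
    Module.Finite.equiv (MonoidAlgebra.coeffLinearEquiv k).symm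
  have : IsArtinianRing Z := IsArtinianRing.of_finite k Z
  let e : Z := ⟨B.idem, B.central⟩
  let c' : Z := ⟨c, hc⟩
  have hee : e * e = e := Subtype.ext B.isIdempotent.eq
  obtain ⟨n, r, hr⟩ := IsArtinian.exists_pow_succ_smul_dvd (c' * e) (1 : Z)
  simp only [smul_eq_mul, mul_one] at hr
  set u := c' * e with hu
  have hue : u * e = u := by rw [hu, mul_assoc, hee]
  have hj : ∀ j : ℕ, u ^ n = u ^ (n + j) * r ^ j := by
    intro j
    induction j with
    | zero => simp
    | succ j ih =>
      calc u ^ n = u ^ (n + j) * r ^ j := ih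
        _ = u ^ n * (u ^ j * r ^ j) := by ring
        _ = (u ^ n.succ * r) * (u ^ j * r ^ j) := by rw [hr]
        _ = _ := by rw [Nat.succ_eq_add_one]; ring
  -- the Fitting idempotent of `u`
  set f : Z := (u * r) ^ (n + 1) with hf
  have hff : f * f = f := by
    have h1 := hj (n + 1)
    calc f * f = u * r ^ (n + 1) * (u ^ (n + (n + 1)) * r ^ (n + 1)) := by rw [hf]; ring
      _ = f := by rw [← h1, hf]; ring
  have huf : u ^ (n + 1) * f = u ^ (n + 1) := by
    have h1 := hj (n + 1)
    calc u ^ (n + 1) * f = u * (u ^ (n + (n + 1)) * r ^ (n + 1)) := by rw [hf]; ring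
      _ = u ^ (n + 1) := by rw [← h1]; ring
  have hfe : f * e = f := by
    calc f * e = u ^ n * (u * e) * r ^ (n + 1) := by rw [hf]; ring
      _ = f := by rw [hue, hf]; ring
  rcases B.idem_eq_or_zero_of_mul_eq f.2 (congrArg Subtype.val hff) (congrArg Subtype.val hfe)
    with h | h
  · left
    have h0 : f = 0 := Subtype.ext h
    rw [h0, mul_zero] at huf
    exact ⟨n + 1, by simpa [hu] using (congrArg Subtype.val huf).symm⟩
  · right
    have h0 : f = e := Subtype.ext h
    refine ⟨_, (e * (u ^ n * r ^ (n + 1))).2, ?_, ?_⟩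
    · refine congrArg Subtype.val (?_ : c' * (e * (u ^ n * r ^ (n + 1))) = e)
      rw [← h0] at hu ⊢
      calc c' * (f * (u ^ n * r ^ (n + 1))) = (c' * f) * (u ^ n * r ^ (n + 1)) := by ring
        _ = f := by rw [← hu, hf]; ring
    · refine congrArg Subtype.val (?_ : (e * (u ^ n * r ^ (n + 1))) * e = _)
      calc (e * (u ^ n * r ^ (n + 1))) * e = (e * e) * (u ^ n * r ^ (n + 1)) := by ring
        _ = _ := by rw [hee]

end GroupBlock

/-! ### Conjugation, support and relative traces in a group algebra -/

/-- The conjugation action `x ↦ g x g⁻¹` of `g ∈ G` on the group algebra `kG`. -/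
noncomputable def conjAlg (k : Type*) {G : Type*} [Field k] [Group G] (g : G) :
    MonoidAlgebra k G ≃ₐ[k] MonoidAlgebra k G :=
  MonoidAlgebra.domCongr k k (MulAut.conj g)

/-- The projection of `kG` onto the span of a subset `S` of `G`, which forgets the coefficients
at the elements outside `S`. For `S = C_G(D)`, this is the Brauer map of `D`, with values in
`kG` rather than in `kC_G(D)`. -/
noncomputable def restrictSupport (k : Type*) {G : Type*} [Field k] (S : Set G) :
    MonoidAlgebra k G →+ MonoidAlgebra k G where
  toFun x := .ofCoeff (by classical exact x.coeff.filter (· ∈ S))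
  map_zero' := by ext; simp [Finsupp.filter_apply]
  map_add' x y := by ext; simp [Finsupp.filter_add]

section conjAlg

variable {k G : Type*} [Field k] [Group G]

theorem coeff_conjAlg (g h : G) (x : MonoidAlgebra k G) :
    (conjAlg k g x).coeff h = x.coeff (g⁻¹ * h * g) := by
  simp [conjAlg]

theorem conjAlg_apply (g : G) (x : MonoidAlgebra k G) :
    conjAlg k g x = MonoidAlgebra.of k G g * x * MonoidAlgebra.of k G g⁻¹ := by
  ext h
  simp [coeff_conjAlg, mul_assoc]

theorem conjAlg_mul (g h : G) (x : MonoidAlgebra k G) :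
    conjAlg k (g * h) x = conjAlg k g (conjAlg k h x) := by
  ext; simp [coeff_conjAlg, mul_assoc]

theorem conjAlg_of (g h : G) :
    conjAlg k g (MonoidAlgebra.of k G h) = MonoidAlgebra.of k G (g * h * g⁻¹) := by
  rw [conjAlg_apply, ← map_mul, ← map_mul]

theorem of_mul_eq_conjAlg_mul (g : G) (x : MonoidAlgebra k G) :
    MonoidAlgebra.of k G g * x = conjAlg k g x * MonoidAlgebra.of k G g := by
  rw [conjAlg_apply, mul_assoc, ← map_mul, inv_mul_cancel, map_one, mul_one]

theorem conjAlg_eq_iff_commute (g : G) (x : MonoidAlgebra k G) :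
    conjAlg k g x = x ↔ Commute (MonoidAlgebra.of k G g) x := by
  rw [Commute, SemiconjBy, of_mul_eq_conjAlg_mul]
  exact ⟨fun h => by rw [h], fun h =>
    ((Group.isUnit g).map (MonoidAlgebra.of k G)).mul_right_cancel h⟩

theorem mem_center_iff_conjAlg {x : MonoidAlgebra k G} :
    x ∈ Subalgebra.center k (MonoidAlgebra k G) ↔ ∀ g, conjAlg k g x = x := by
  rw [Subalgebra.mem_center_iff]
  refine ⟨fun h g => (conjAlg_eq_iff_commute g x).2 (h _), fun h y => ?_⟩
  induction y using MonoidAlgebra.induction_on with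
  | of g => exact (conjAlg_eq_iff_commute g x).1 (h g)
  | add a b ha hb => rw [add_mul, mul_add, ha, hb]
  | smul r a ha => rw [smul_mul_assoc, mul_smul_comm, ha]

end conjAlg

section restrictSupport

variable {k G : Type*} [Field k]

theorem coeff_restrictSupport_of_mem {S : Set G} {g : G} (h : g ∈ S) (x : MonoidAlgebra k G) :
    (restrictSupport k S x).coeff g = x.coeff g := by
  simp [restrictSupport, h]

theorem coeff_restrictSupport_of_notMem {S : Set G} {g : G} (h : g ∉ S) (x : MonoidAlgebra k G) :
    (restrictSupport k S x).coeff g = 0 := by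
  simp [restrictSupport, h]

variable [Group G]

theorem conjAlg_restrictSupport {S T : Set G} {g : G} (hS : ∀ h, g⁻¹ * h * g ∈ S ↔ h ∈ T)
    (x : MonoidAlgebra k G) :
    conjAlg k g (restrictSupport k S x) = restrictSupport k T (conjAlg k g x) := by
  ext h
  by_cases hh : h ∈ T
  · rw [coeff_conjAlg, coeff_restrictSupport_of_mem ((hS h).2 hh),
      coeff_restrictSupport_of_mem hh, coeff_conjAlg]
  · rw [coeff_conjAlg, coeff_restrictSupport_of_notMem (mt (hS h).1 hh),
      coeff_restrictSupport_of_notMem hh]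

theorem of_mul_restrictSupport {S : Set G} {g : G} (hS : ∀ h, g⁻¹ * h ∈ S ↔ h ∈ S)
    (x : MonoidAlgebra k G) :
    MonoidAlgebra.of k G g * restrictSupport k S x =
      restrictSupport k S (MonoidAlgebra.of k G g * x) := by
  ext h
  by_cases hh : h ∈ S
  · rw [coeff_restrictSupport_of_mem hh]
    simp [coeff_restrictSupport_of_mem ((hS h).2 hh)]
  · rw [coeff_restrictSupport_of_notMem hh]
    simp [coeff_restrictSupport_of_notMem (mt (hS h).1 hh)]

theorem commute_of_restrictSupport_centralizer {D : Subgroup G} {d : G} (hd : d ∈ D)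
    (x : MonoidAlgebra k G) : Commute (MonoidAlgebra.of k G d)
      (restrictSupport k (Subgroup.centralizer (D : Set G) : Set G) x) := by
  rw [← conjAlg_eq_iff_commute]
  ext h
  rw [coeff_conjAlg]
  by_cases hh : h ∈ Subgroup.centralizer (D : Set G)
  · have h1 : d⁻¹ * h * d = h := by
      rw [mul_assoc, ← Subgroup.mem_centralizer_iff.1 hh d hd, inv_mul_cancel_left]
    rw [h1]
  · rw [coeff_restrictSupport_of_notMem hh, coeff_restrictSupport_of_notMem]
    intro hc
    refine hh ?_
    have h1 : d⁻¹ * h * d = h := by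
      have := Subgroup.mem_centralizer_iff.1 hc d hd
      calc d⁻¹ * h * d = d⁻¹ * h * d * d * d⁻¹ := by group
        _ = d * (d⁻¹ * h * d) * d⁻¹ := by rw [this]
        _ = h := by group
    rwa [h1] at hc

end restrictSupport

section trace

variable {k G : Type*} [Field k] [Group G]

theorem relativeTrace_eq_sum (H : Subgroup G) [Fintype (G ⧸ H)] (a : MonoidAlgebra k G) :
    relativeTrace k H a = ∑ q : G ⧸ H, conjAlg k q.out a := by
  simp only [relativeTrace, finsum_eq_sum_of_fintype, conjAlg_apply]

theorem conjAlg_out_mk {H : Subgroup G} {a : MonoidAlgebra k G}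
    (ha : ∀ h ∈ H, conjAlg k h a = a) (g : G) :
    conjAlg k (g : G ⧸ H).out a = conjAlg k g a := by
  obtain ⟨h, hh⟩ := QuotientGroup.mk_out_eq_mul H g
  rw [hh, conjAlg_mul, ha _ h.2]

theorem relativeTrace_mem_center [Finite G] {H : Subgroup G} {a : MonoidAlgebra k G}
    (ha : ∀ h ∈ H, conjAlg k h a = a) :
    relativeTrace k H a ∈ Subalgebra.center k (MonoidAlgebra k G) := by
  have := Fintype.ofFinite (G ⧸ H)
  rw [mem_center_iff_conjAlg]
  intro g
  rw [relativeTrace_eq_sum, map_sum]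
  refine Fintype.sum_equiv (MulAction.toPerm g) _ _ fun q => ?_
  rw [← conjAlg_mul, MulAction.toPerm_apply, ← conjAlg_out_mk ha (g * q.out),
    ← smul_eq_mul, ← MulAction.Quotient.smul_mk, QuotientGroup.out_eq']

theorem relativeTrace_mul [Finite G] (H : Subgroup G) (a : MonoidAlgebra k G)
    {z : MonoidAlgebra k G} (hz : z ∈ Subalgebra.center k (MonoidAlgebra k G)) :
    relativeTrace k H (a * z) = relativeTrace k H a * z := by
  have := Fintype.ofFinite (G ⧸ H)
  rw [relativeTrace_eq_sum, relativeTrace_eq_sum, Finset.sum_mul]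
  exact Finset.sum_congr rfl fun q _ => by rw [map_mul, mem_center_iff_conjAlg.1 hz]

theorem relativeTrace_sum [Finite G] (H : Subgroup G) {ι : Type*} (s : Finset ι)
    (a : ι → MonoidAlgebra k G) :
    relativeTrace k H (∑ i ∈ s, a i) = ∑ i ∈ s, relativeTrace k H (a i) := by
  have := Fintype.ofFinite (G ⧸ H)
  simp only [relativeTrace_eq_sum, map_sum]
  exact Finset.sum_comm

theorem relativeTrace_sub [Finite G] (H : Subgroup G) (a b : MonoidAlgebra k G) :
    relativeTrace k H (a - b) = relativeTrace k H a - relativeTrace k H b := by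
  have := Fintype.ofFinite (G ⧸ H)
  simp only [relativeTrace_eq_sum, map_sub, Finset.sum_sub_distrib]

/-- Transitivity `Tr_P^G = Tr_D^G ∘ Tr_P^D` of the relative trace. -/
theorem relativeTrace_eq_relativeTrace_sum [Finite G] {P D : Subgroup G} (hPD : P ≤ D)
    [Fintype (D ⧸ P.subgroupOf D)] {a : MonoidAlgebra k G} (ha : ∀ h ∈ P, conjAlg k h a = a) :
    relativeTrace k P a =
      relativeTrace k D (∑ r : D ⧸ P.subgroupOf D, conjAlg k (r.out : G) a) := by
  have := Fintype.ofFinite (G ⧸ D)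
  have := Fintype.ofFinite (G ⧸ P)
  rw [relativeTrace_eq_sum, relativeTrace_eq_sum]
  simp only [map_sum]
  rw [← Fintype.sum_prod_type' (f := fun (q : G ⧸ D) (r : D ⧸ P.subgroupOf D) =>
    conjAlg k q.out (conjAlg k (r.out : G) a))]
  refine (Fintype.sum_equiv (Subgroup.quotientEquivProdOfLE hPD).symm _ _ ?_).symm
  rintro ⟨q, r⟩
  have h1 : (Subgroup.quotientEquivProdOfLE hPD).symm (q, r) = ((q.out * r.out : G) : G ⧸ P) := by
    nth_rewrite 1 [← QuotientGroup.out_eq' r]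
    rfl
  rw [h1, conjAlg_out_mk ha, conjAlg_mul]

end trace

/-! ### The Brauer map of a `p`-group -/

/-- In characteristic `p`, an invariant function under a `p`-group has the same sum over the whole
set as over the fixed points, because the other orbits have length divisible by `p`. The action is
given by a homomorphism, so that it need not be a registered instance. -/
theorem IsPGroup.sum_eq_sum_fixed {p : ℕ} [Fact p.Prime] {P : Type*} [Group P] (hP : IsPGroup p P)
    {α : Type*} [Fintype α] {k : Type*} [Field k] [CharP k p] (φ : P →* Equiv.Perm α) (f : α → k)
    (hf : ∀ g a, f (φ g a) = f a) [DecidablePred fun a => ∀ g, φ g a = a] :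
    ∑ a, f a = ∑ a with ∀ g, φ g a = a, f a := by
  classical
  -- the level sets of `f` are invariant, so their cardinalities can be compared modulo `p`
  have hcard : ∀ v : k, (({a | f a = v} : Finset α).card : k) =
      ({a | (∀ g, φ g a = a) ∧ f a = v} : Finset α).card := by
    intro v
    let _ : MulAction P α := MulAction.compHom α φ
    let S : SubMulAction P α := ⟨{a | f a = v}, fun g a (ha : f a = v) => (hf g a).trans ha⟩
    have h1 := (CharP.cast_eq_iff_mod_eq k p).2 (hP.card_modEq_card_fixedPoints S)
    have h2 : Nat.card S = ({a | f a = v} : Finset α).card := by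
      rw [← Fintype.card_subtype, ← Nat.card_eq_fintype_card]
      rfl
    have h3 : Nat.card (MulAction.fixedPoints P S) =
        ({a | (∀ g, φ g a = a) ∧ f a = v} : Finset α).card := by
      rw [← Fintype.card_subtype, ← Nat.card_eq_fintype_card]
      exact Nat.card_congr
        { toFun := fun x => ⟨x.1.1, fun g => congrArg Subtype.val (x.2 g), x.1.2⟩
          invFun := fun x => ⟨⟨x.1, x.2.2⟩, fun g => Subtype.ext (x.2.1 g)⟩
          left_inv := fun _ => rfl
          right_inv := fun _ => rfl }
    rw [← h2, h1, h3]
  have hfib : ∀ s : Finset α, ∑ a ∈ s, f a =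
      ∑ v ∈ Finset.univ.image f, (({a ∈ s | f a = v} : Finset α).card : k) * v := by
    intro s
    rw [← Finset.sum_fiberwise_of_maps_to (s := s) (t := Finset.univ.image f) (g := f)
      (fun a _ => Finset.mem_image_of_mem f (Finset.mem_univ a))]
    refine Finset.sum_congr rfl fun v _ => ?_
    rw [Finset.sum_congr rfl (fun a ha => (Finset.mem_filter.1 ha).2), Finset.sum_const,
      nsmul_eq_mul]
  rw [hfib, hfib]
  refine Finset.sum_congr rfl fun v _ => ?_
  rw [Finset.filter_filter, hcard]

theorem inv_mul_mul_mem_centralizer_iff {G : Type*} [Group G] {D : Subgroup G} {g : G}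
    (hg : g ∈ Subgroup.normalizer (D : Set G)) (c : G) :
    g⁻¹ * c * g ∈ Subgroup.centralizer (D : Set G) ↔ c ∈ Subgroup.centralizer (D : Set G) := by
  have key : ∀ g ∈ Subgroup.normalizer (D : Set G), ∀ c ∈ Subgroup.centralizer (D : Set G),
      g⁻¹ * c * g ∈ Subgroup.centralizer (D : Set G) := by
    intro g hg c hc
    rw [Subgroup.mem_centralizer_iff] at hc ⊢
    intro d hd
    have h1 := hc _ ((Subgroup.mem_normalizer_iff.1 hg d).1 hd)
    calc d * (g⁻¹ * c * g) = g⁻¹ * (g * d * g⁻¹ * c) * g := by group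
      _ = g⁻¹ * c * g * d := by rw [h1]; group
  refine ⟨fun h => ?_, key g hg c⟩
  have := key g⁻¹ (inv_mem hg) _ h
  simpa [mul_assoc] using this

section brauer

variable {p : ℕ} [Fact p.Prime] {k G : Type*} [Field k] [CharP k p] [Group G] [Finite G]

/-- The Brauer map `(kG)^D → kC_G(D)` of a `p`-group `D` is multiplicative. -/
theorem restrictSupport_centralizer_mul {D : Subgroup G} (hD : IsPGroup p D)
    {x y : MonoidAlgebra k G} (hx : ∀ d ∈ D, conjAlg k d x = x) (hy : ∀ d ∈ D, conjAlg k d y = y) :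
    restrictSupport k (Subgroup.centralizer (D : Set G) : Set G) (x * y) =
      restrictSupport k (Subgroup.centralizer (D : Set G) : Set G) x *
        restrictSupport k (Subgroup.centralizer (D : Set G) : Set G) y := by
  classical
  cases nonempty_fintype G
  have hmul : ∀ (x y : MonoidAlgebra k G) (c : G),
      (x * y).coeff c = ∑ g, x.coeff g * y.coeff (g⁻¹ * c) := by
    intro x y c
    rw [MonoidAlgebra.coeff_mul_apply_left, Finsupp.sum_fintype _ _ (by simp)]
  have hinv : ∀ {x : MonoidAlgebra k G}, (∀ d ∈ D, conjAlg k d x = x) → ∀ d ∈ D, ∀ g,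
      x.coeff (d * g * d⁻¹) = x.coeff g := by
    intro x hx d hd g
    nth_rewrite 1 [← hx d hd]
    rw [coeff_conjAlg]
    group
  ext c
  by_cases hc : c ∈ Subgroup.centralizer (D : Set G)
  · rw [coeff_restrictSupport_of_mem hc, hmul, hmul,
      hD.sum_eq_sum_fixed (MulAut.toPerm G |>.comp (MulAut.conj.comp D.subtype)),
      Finset.sum_filter]
    · refine Finset.sum_congr rfl fun g _ => ?_
      have hiff : (∀ d : D, ((MulAut.toPerm G).comp (MulAut.conj.comp D.subtype)) d g = g) ↔
          g ∈ Subgroup.centralizer (D : Set G) := by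
        rw [Subgroup.mem_centralizer_iff]
        constructor
        · intro h d hd
          exact mul_inv_eq_iff_eq_mul.1 (h ⟨d, hd⟩)
        · intro h d
          exact mul_inv_eq_iff_eq_mul.2 (h d d.2)
      split_ifs with h
      · rw [hiff] at h
        rw [coeff_restrictSupport_of_mem h,
          coeff_restrictSupport_of_mem (mul_mem (inv_mem h) hc)]
      · rw [hiff] at h
        rw [coeff_restrictSupport_of_notMem h, zero_mul]
    · rintro ⟨d, hd⟩ g
      change x.coeff (d * g * d⁻¹) * y.coeff ((d * g * d⁻¹)⁻¹ * c) = _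
      have h1 : (d * g * d⁻¹)⁻¹ * c = d * (g⁻¹ * c) * d⁻¹ := by
        have h2 : d⁻¹ * c = c * d⁻¹ :=
          Subgroup.mem_centralizer_iff.1 hc _ (inv_mem hd)
        simp only [mul_inv_rev, inv_inv, mul_assoc, h2]
      rw [h1, hinv hx d hd, hinv hy d hd]
  · rw [coeff_restrictSupport_of_notMem hc, hmul]
    refine (Finset.sum_eq_zero fun g _ => ?_).symm
    by_cases hg : g ∈ Subgroup.centralizer (D : Set G)
    · rw [coeff_restrictSupport_of_notMem (S := (Subgroup.centralizer (D : Set G) : Set G))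
        (g := g⁻¹ * c), mul_zero]
      intro h
      exact hc (by simpa using mul_mem hg h)
    · rw [coeff_restrictSupport_of_notMem hg, zero_mul]

theorem restrictSupport_centralizer_pow {D : Subgroup G} (hD : IsPGroup p D)
    {x : MonoidAlgebra k G} (hx : x ∈ Subalgebra.center k (MonoidAlgebra k G)) {n : ℕ}
    (hn : n ≠ 0) :
    restrictSupport k (Subgroup.centralizer (D : Set G) : Set G) (x ^ n) =
      restrictSupport k (Subgroup.centralizer (D : Set G) : Set G) x ^ n := by
  induction n, Nat.one_le_iff_ne_zero.2 hn using Nat.le_induction with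
  | base => rw [pow_one, pow_one]
  | succ n h1 ih =>
    rw [pow_succ, pow_succ, ← ih (by omega), restrictSupport_centralizer_mul hD
      (fun d _ => mem_center_iff_conjAlg.1 (pow_mem hx n) d)
      (fun d _ => mem_center_iff_conjAlg.1 hx d)]

/-- Only the cosets `gD` with `g ∈ N_G(D)` contribute to the image of a relative trace under the
Brauer map, since they are the fixed points of the `p`-group `D` on `G ⧸ D`. -/
theorem restrictSupport_centralizer_relativeTrace {D : Subgroup G} (hD : IsPGroup p D)
    [Fintype (G ⧸ D)] [DecidablePred fun q : G ⧸ D => q.out ∈ Subgroup.normalizer (D : Set G)]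
    {y : MonoidAlgebra k G} (hy : ∀ d ∈ D, conjAlg k d y = y) :
    restrictSupport k (Subgroup.centralizer (D : Set G) : Set G) (relativeTrace k D y) =
      ∑ q : G ⧸ D with q.out ∈ Subgroup.normalizer (D : Set G),
        conjAlg k q.out (restrictSupport k (Subgroup.centralizer (D : Set G) : Set G) y) := by
  classical
  have h0 : ∀ q ∈ ({q | q.out ∈ Subgroup.normalizer (D : Set G)} : Finset (G ⧸ D)),
      conjAlg k q.out (restrictSupport k (Subgroup.centralizer (D : Set G) : Set G) y) =
        restrictSupport k (Subgroup.centralizer (D : Set G) : Set G) (conjAlg k q.out y) :=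
    fun q hq => conjAlg_restrictSupport
      (inv_mul_mul_mem_centralizer_iff (Finset.mem_filter.1 hq).2) y
  rw [Finset.sum_congr rfl h0, ← map_sum, relativeTrace_eq_sum]
  ext c
  by_cases hc : c ∈ Subgroup.centralizer (D : Set G)
  · rw [coeff_restrictSupport_of_mem hc, coeff_restrictSupport_of_mem hc]
    simp only [MonoidAlgebra.coeff_sum, Finsupp.coe_finsetSum, Finset.sum_apply]
    rw [hD.sum_eq_sum_fixed ((MulAction.toPermHom G (G ⧸ D)).comp D.subtype)]
    · refine Finset.sum_congr (Finset.filter_congr fun q _ => ?_) fun _ _ => rfl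
      rw [← Sylow.mem_fixedPoints_mul_left_cosets_iff_mem_normalizer, QuotientGroup.out_eq']
      rfl
    · rintro ⟨d, hd⟩ q
      have h1 : conjAlg k (d • q).out y = conjAlg k d (conjAlg k q.out y) := by
        rw [← conjAlg_mul, ← conjAlg_out_mk hy (d * q.out), ← smul_eq_mul,
          ← MulAction.Quotient.smul_mk, QuotientGroup.out_eq']
      change (conjAlg k (d • q).out y).coeff c = _
      rw [h1, coeff_conjAlg, mul_assoc, ← Subgroup.mem_centralizer_iff.1 hc d hd,
        inv_mul_cancel_left]
  · rw [coeff_restrictSupport_of_notMem hc, coeff_restrictSupport_of_notMem hc]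

end brauer

/-! ### Defect groups -/

/-- An element of `kG` fixed by `D` is a sum, over the `D`-conjugacy classes in `G`, of multiples
of class sums, each of which is a relative trace from a centralizer in `D`. -/
theorem exists_finset_eq_sum_conjAlg {k G : Type*} [Field k] [Group G]
    [Finite G] (D : Subgroup G) {x : MonoidAlgebra k G}
    (hx : ∀ d ∈ D, conjAlg k d x = x)
    [∀ h : G, Fintype (D ⧸ (D ⊓ Subgroup.centralizer {h}).subgroupOf D)] :
    ∃ T : Finset G, x = ∑ h ∈ T, ∑ r : D ⧸ (D ⊓ Subgroup.centralizer {h}).subgroupOf D,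
      conjAlg k (r.out : G) (MonoidAlgebra.single h (x.coeff h)) := by
  classical
  cases nonempty_fintype G
  let s : Setoid G :=
    { r := fun g h => ∃ d : D, (d : G) * g * (d : G)⁻¹ = h
      iseqv :=
        { refl := fun g => ⟨1, by simp⟩
          symm := by
            rintro g h ⟨d, rfl⟩
            exact ⟨d⁻¹, by simp [mul_assoc]⟩
          trans := by
            rintro g h l ⟨d, rfl⟩ ⟨d', rfl⟩
            exact ⟨d' * d, by simp [mul_assoc]⟩ } }
  have hout : ∀ ω : Quotient s, (⟦ω.out⟧ : Quotient s) = ω := Quotient.out_eq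
  refine ⟨Finset.univ.image (Quotient.out : Quotient s → G), ?_⟩
  rw [Finset.sum_image (fun a _ b _ h => Quotient.out_injective h)]
  have h1 : x = ∑ g, MonoidAlgebra.single g (x.coeff g) := by
    nth_rewrite 1 [← MonoidAlgebra.sum_coeff_single x]
    exact Finsupp.sum_fintype _ _ (by simp)
  nth_rewrite 1 [h1]
  rw [← Finset.sum_fiberwise_of_maps_to (t := Finset.univ) (g := fun g => (⟦g⟧ : Quotient s))
    (fun _ _ => Finset.mem_univ _)]
  refine Finset.sum_congr rfl fun ω _ => ?_
  set h := ω.out with hh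
  have hsingle : ∀ d : D, conjAlg k (d : G) (MonoidAlgebra.single h (x.coeff h)) =
      MonoidAlgebra.single (d * h * d⁻¹ : G) (x.coeff (d * h * d⁻¹ : G)) := by
    intro d
    have h2 : x.coeff (d * h * d⁻¹ : G) = x.coeff h := by
      nth_rewrite 1 [← hx d d.2]
      rw [coeff_conjAlg]
      simp [mul_assoc]
    rw [h2]
    simp [conjAlg]
  have hcomm : ∀ d d' : D, (d : G) * h * (d : G)⁻¹ = d' * h * (d' : G)⁻¹ ↔
      (d : D ⧸ (D ⊓ Subgroup.centralizer {h}).subgroupOf D) = d' := by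
    intro d d'
    rw [QuotientGroup.eq, Subgroup.mem_subgroupOf, Subgroup.mem_inf,
      Subgroup.mem_centralizer_singleton_iff]
    simp only [Subgroup.coe_mul, Subgroup.coe_inv]
    constructor
    · intro h3
      refine ⟨mul_mem (inv_mem d.2) d'.2, ?_⟩
      calc (d : G)⁻¹ * d' * h = (d : G)⁻¹ * (d' * h * (d' : G)⁻¹) * d' := by group
        _ = h * ((d : G)⁻¹ * d') := by rw [← h3]; group
    · rintro ⟨-, h3⟩
      calc (d : G) * h * (d : G)⁻¹ = d * (h * ((d : G)⁻¹ * d')) * (d' : G)⁻¹ := by group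
        _ = d' * h * (d' : G)⁻¹ := by rw [← h3]; group
  symm
  refine Finset.sum_bij (fun r _ => (r.out : G) * h * (r.out : G)⁻¹) ?_ ?_ ?_ ?_
  · intro r _
    refine Finset.mem_filter.2 ⟨Finset.mem_univ _, ?_⟩
    rw [← hout ω]
    exact Quotient.sound (Setoid.symm ⟨r.out, rfl⟩)
  · intro r _ r' _ h3
    simpa using (hcomm _ _).1 h3
  · intro g hg
    have h3 : (⟦ω.out⟧ : Quotient s) = ⟦g⟧ := (hout ω).trans (Finset.mem_filter.1 hg).2.symm
    obtain ⟨d, hd⟩ := Quotient.exact h3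
    refine ⟨(d : D ⧸ _), Finset.mem_univ _, ?_⟩
    rw [← hd]
    exact (hcomm _ _).2 (QuotientGroup.out_eq' _)
  · intro r _
    exact hsingle r.out

namespace GroupBlock

variable {p : ℕ} [Fact p.Prime] {k G : Type*} [Field k] [Group G]
  {B : GroupBlock k G} {D : Subgroup G}

theorem IsDefectGroup.exists_relativeTrace (hD : B.IsDefectGroup D) :
    ∃ a, (∀ d ∈ D, conjAlg k d a = a) ∧ relativeTrace k D a = B.idem := by
  simp only [conjAlg_apply]
  exact hD.prop

theorem IsDefectGroup.eq_of_le (hD : B.IsDefectGroup D) {P : Subgroup G} (hPD : P ≤ D)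
    {a : MonoidAlgebra k G} (ha : ∀ d ∈ P, conjAlg k d a = a)
    (haB : relativeTrace k P a = B.idem) : P = D := by
  simp only [conjAlg_apply] at ha
  exact Minimal.eq_of_le hD ⟨a, ha, haB⟩ hPD

variable [Finite G]

/-- A Sylow `p`-subgroup `P` of `D` satisfies `Tr_D^G(a) = Tr_P^G([D : P]⁻¹ a)`, so `P = D` by the
minimality of `D`. -/
theorem IsDefectGroup.isPGroup [CharP k p] (hD : B.IsDefectGroup D) : IsPGroup p D := by
  obtain ⟨a, ha, haB⟩ := hD.exists_relativeTrace
  obtain ⟨P⟩ : Nonempty (Sylow p D) := inferInstance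
  have hPD : (P : Subgroup D).map D.subtype ≤ D := Subgroup.map_subtype_le _
  have hsub : ((P : Subgroup D).map D.subtype).subgroupOf D = P := by
    rw [Subgroup.subgroupOf, Subgroup.comap_map_eq_self_of_injective D.subtype_injective]
  have := Fintype.ofFinite (D ⧸ ((P : Subgroup D).map D.subtype).subgroupOf D)
  set n := Fintype.card (D ⧸ ((P : Subgroup D).map D.subtype).subgroupOf D) with hn
  have hn0 : (n : k) ≠ 0 := by
    rw [Ne, CharP.cast_eq_zero_iff k p, hn, ← Nat.card_eq_fintype_card, ← Subgroup.index, hsub]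
    exact P.not_dvd_index
  have hfix : ∀ d ∈ D, conjAlg k d ((n : k)⁻¹ • a) = (n : k)⁻¹ • a := fun d hd => by
    rw [map_smul, ha d hd]
  have h1 := hD.eq_of_le hPD (a := (n : k)⁻¹ • a) (fun d hd => hfix d (hPD hd)) (by
    rw [relativeTrace_eq_relativeTrace_sum hPD (fun d hd => hfix d (hPD hd)),
      Finset.sum_congr rfl (fun r _ => hfix _ r.out.2), Finset.sum_const, Finset.card_univ, ← hn,
      ← Nat.cast_smul_eq_nsmul k, smul_smul, mul_inv_cancel₀ hn0, one_smul, haB])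
  rw [← h1]
  exact P.isPGroup'.map D.subtype

/-- The Brauer map of a defect group does not kill the block idempotent. Otherwise `e_B` is a sum
of relative traces from proper subgroups of `D`; as `Z(kG) e_B` is local, one of the summands is
invertible in it, so `e_B` itself is a relative trace from a proper subgroup of `D`. -/
theorem IsDefectGroup.restrictSupport_idem_ne_zero (hD : B.IsDefectGroup D) :
    restrictSupport k (Subgroup.centralizer (D : Set G) : Set G) B.idem ≠ 0 := by
  intro h0
  obtain ⟨a, ha, haB⟩ := hD.exists_relativeTrace
  have hef := mem_center_iff_conjAlg.1 B.central
  have := fun h : G => Fintype.ofFinite (D ⧸ (D ⊓ Subgroup.centralizer {h}).subgroupOf D)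
  obtain ⟨T, hT⟩ := exists_finset_eq_sum_conjAlg D (x := B.idem) fun d _ => hef d
  let y : G → MonoidAlgebra k G := fun h => a * MonoidAlgebra.single h (B.idem.coeff h)
  have hy : ∀ h, ∀ d ∈ D ⊓ Subgroup.centralizer {h}, conjAlg k d (y h) = y h := by
    rintro h d ⟨hd, hdh⟩
    have h1 : d * h * d⁻¹ = h :=
      mul_inv_eq_iff_eq_mul.2 (Subgroup.mem_centralizer_singleton_iff.1 hdh)
    rw [map_mul, ha d hd]
    simp [y, conjAlg, h1]
  have hsum : B.idem = ∑ h ∈ T, relativeTrace k (D ⊓ Subgroup.centralizer {h}) (y h) := by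
    calc B.idem = relativeTrace k D (a * B.idem) := by
          rw [relativeTrace_mul _ _ B.central, haB, B.isIdempotent.eq]
      _ = ∑ h ∈ T, relativeTrace k (D ⊓ Subgroup.centralizer {h}) (y h) := by
          nth_rewrite 1 [hT]
          rw [Finset.mul_sum, relativeTrace_sum]
          refine Finset.sum_congr rfl fun h _ => ?_
          rw [relativeTrace_eq_relativeTrace_sum inf_le_left (hy h), Finset.mul_sum]
          refine congrArg _ (Finset.sum_congr rfl fun r _ => ?_)
          rw [map_mul, ha _ r.out.2]
  have hz := fun h => relativeTrace_mem_center (hy h)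
  have hnil : ∀ h, IsNilpotent (relativeTrace k (D ⊓ Subgroup.centralizer {h}) (y h) * B.idem) := by
    intro h
    rcases B.isNilpotent_or_exists_mul_eq_idem (hz h) with h1 | ⟨d, hd, hde, -⟩
    · exact h1
    rw [← relativeTrace_mul _ _ hd] at hde
    have hle : D ⊓ Subgroup.centralizer {h} = D := hD.eq_of_le inf_le_left
      (fun g hg => by rw [map_mul, hy h g hg, mem_center_iff_conjAlg.1 hd]) hde
    have hc : h ∈ Subgroup.centralizer (D : Set G) := by
      rw [Subgroup.mem_centralizer_iff]
      intro g hg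
      exact Subgroup.mem_centralizer_singleton_iff.1 (inf_eq_left.1 hle hg)
    have h2 : y h = 0 := by
      have h3 := coeff_restrictSupport_of_mem
        (S := (Subgroup.centralizer (D : Set G) : Set G)) hc B.idem
      rw [h0] at h3
      simp [y, ← h3]
    rw [h2, ← zero_mul (0 : MonoidAlgebra k G), relativeTrace_mul _ _ (zero_mem _), mul_zero,
      zero_mul]
    exact IsNilpotent.zero
  have hc : ∀ h x, Commute (relativeTrace k (D ⊓ Subgroup.centralizer {h}) (y h) * B.idem) x :=
    fun h x => (Subalgebra.mem_center_iff.1 (mul_mem (hz h) B.central) x).symm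
  have h1 : IsNilpotent B.idem := by
    have h2 := isNilpotent_sum_commuting_mul T
      (fun h => relativeTrace k (D ⊓ Subgroup.centralizer {h}) (y h) * B.idem) (fun _ => 1)
      (fun h _ => hnil h) (fun h _ _ _ => hc h _) (fun h _ _ _ => hc h _)
    simp only [mul_one] at h2
    rwa [← Finset.sum_mul, ← hsum, B.isIdempotent.eq] at h2
  exact B.ne_zero (B.isIdempotent.eq_zero_of_isNilpotent h1)

end GroupBlock

/-! ### The grading of the group algebra by a normal subgroup -/

section groupAlgebraOfNormal

variable {k G : Type*} [Field k] [Group G] {N : Subgroup G}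

theorem mapDomainAlgHom_subtype_injective :
    Function.Injective (MonoidAlgebra.mapDomainAlgHom k k N.subtype) :=
  MonoidAlgebra.mapDomain_injective N.subtype_injective

theorem exists_mapDomainAlgHom_subtype_eq {y : MonoidAlgebra k G}
    (hy : ∀ g, y.coeff g ≠ 0 → g ∈ N) :
    ∃ s, MonoidAlgebra.mapDomainAlgHom k k N.subtype s = y := by
  refine ⟨.ofCoeff (y.coeff.comapDomain N.subtype N.subtype_injective.injOn), ?_⟩
  refine MonoidAlgebra.coeff_injective ?_
  refine Finsupp.mapDomain_comapDomain N.subtype N.subtype_injective y.coeff fun g hg => ?_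
  exact ⟨⟨g, hy g (Finsupp.mem_support_iff.1 hg)⟩, rfl⟩

theorem commute_mapDomainAlgHom_subtype {y : MonoidAlgebra k G}
    (hy : ∀ n ∈ N, conjAlg k n y = y) (s : MonoidAlgebra k N) :
    Commute (MonoidAlgebra.mapDomainAlgHom k k N.subtype s) y := by
  induction s using MonoidAlgebra.induction_on with
  | of n =>
    have h : MonoidAlgebra.mapDomainAlgHom k k N.subtype (MonoidAlgebra.of k N n) =
        MonoidAlgebra.of k G n := MonoidAlgebra.mapDomain_single
    rw [h]
    exact (conjAlg_eq_iff_commute _ _).1 (hy n n.2)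
  | add a b ha hb => rw [map_add]; exact ha.add_left hb
  | smul r a ha => rw [map_smul]; exact ha.smul_left r

theorem mapDomainAlgHom_conjGroupAlgebra [N.Normal] (g : G) (s : MonoidAlgebra k N) :
    MonoidAlgebra.mapDomainAlgHom k k N.subtype (conjGroupAlgebra k N g s) =
      conjAlg k g (MonoidAlgebra.mapDomainAlgHom k k N.subtype s) := by
  induction s using MonoidAlgebra.induction_on with
  | of n =>
    rw [conjGroupAlgebra, conjAlg]
    simp
  | add a b ha hb => simp only [map_add, ha, hb]
  | smul r a ha => simp only [map_smul, ha]

/-- `y` lies in the component `k[Ng] = (kN) g` of the `G ⧸ N`-grading of `kG`, where `q = Ng = gN`. -/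
def IsHomogeneousAt (N : Subgroup G) (q : G ⧸ N) (y : MonoidAlgebra k G) : Prop :=
  ∃ (s : MonoidAlgebra k N) (g : G), (g : G ⧸ N) = q ∧
    y = MonoidAlgebra.mapDomainAlgHom k k N.subtype s * MonoidAlgebra.of k G g

theorem isHomogeneousAt_of (g : G) : IsHomogeneousAt N (g : G ⧸ N) (MonoidAlgebra.of k G g) :=
  ⟨1, g, rfl, by rw [map_one, one_mul]⟩

variable [N.Normal]

theorem IsHomogeneousAt.mul {q r : G ⧸ N} {x y : MonoidAlgebra k G} (hx : IsHomogeneousAt N q x)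
    (hy : IsHomogeneousAt N r y) : IsHomogeneousAt N (q * r) (x * y) := by
  obtain ⟨s, g, rfl, rfl⟩ := hx
  obtain ⟨t, h, rfl, rfl⟩ := hy
  refine ⟨s * conjGroupAlgebra k N g t, g * h, rfl, ?_⟩
  rw [map_mul, map_mul, mapDomainAlgHom_conjGroupAlgebra, mul_assoc,
    ← mul_assoc (MonoidAlgebra.of k G g), of_mul_eq_conjAlg_mul]
  simp only [mul_assoc]

theorem isHomogeneousAt_one_of_mapDomain (s : MonoidAlgebra k N) :
    IsHomogeneousAt N 1 (MonoidAlgebra.mapDomainAlgHom k k N.subtype s) :=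
  ⟨s, 1, rfl, by rw [map_one, mul_one]⟩

theorem IsHomogeneousAt.pow {q : G ⧸ N} {x : MonoidAlgebra k G} (hx : IsHomogeneousAt N q x)
    (n : ℕ) : IsHomogeneousAt N (q ^ n) (x ^ n) := by
  induction n with
  | zero =>
    rw [pow_zero, pow_zero, ← map_one (MonoidAlgebra.mapDomainAlgHom k k N.subtype)]
    exact isHomogeneousAt_one_of_mapDomain 1
  | succ n ih => rw [pow_succ, pow_succ]; exact ih.mul hx

theorem IsHomogeneousAt.exists_eq {x : MonoidAlgebra k G} (hx : IsHomogeneousAt N 1 x) :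
    ∃ s, MonoidAlgebra.mapDomainAlgHom k k N.subtype s = x := by
  obtain ⟨s, g, hg, rfl⟩ := hx
  refine ⟨s * MonoidAlgebra.of k N ⟨g, (QuotientGroup.eq_one_iff g).1 hg⟩, ?_⟩
  rw [map_mul]
  exact congrArg _ MonoidAlgebra.mapDomain_single

theorem isHomogeneousAt_restrictSupport (q : G ⧸ N) (z : MonoidAlgebra k G) :
    IsHomogeneousAt N q (restrictSupport k {g : G | (g : G ⧸ N) = q} z) := by
  obtain ⟨g, rfl⟩ := QuotientGroup.mk_surjective q
  obtain ⟨s, hs⟩ := exists_mapDomainAlgHom_subtype_eq (N := N)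
    (y := restrictSupport k {h : G | (h : G ⧸ N) = g} z * MonoidAlgebra.of k G g⁻¹) (by
      intro h hh
      by_contra hN
      refine hh ?_
      have h1 : h * g ∉ {h : G | (h : G ⧸ N) = g} := fun h2 => hN <| by
        rw [Set.mem_ofPred_eq, QuotientGroup.mk_mul, mul_eq_right] at h2
        exact (QuotientGroup.eq_one_iff h).1 h2
      simp [coeff_restrictSupport_of_notMem h1])
  refine ⟨s, g, rfl, ?_⟩
  rw [hs, mul_assoc, ← map_mul, inv_mul_cancel, map_one, mul_one]

end groupAlgebraOfNormal

/-! ### The centralizer of a stable block -/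

namespace GroupBlock

variable {k G : Type*} [Field k] [Group G] {N : Subgroup G} [N.Normal] {b : GroupBlock k N}

theorem IsStable.mapDomain_idem_mem_center (hb : b.IsStable) :
    MonoidAlgebra.mapDomainAlgHom k k N.subtype b.idem ∈
      Subalgebra.center k (MonoidAlgebra k G) := by
  rw [mem_center_iff_conjAlg]
  intro g
  rw [← mapDomainAlgHom_conjGroupAlgebra, hb g]

theorem IsStable.normal_innerSubgroup (hb : b.IsStable) : b.innerSubgroup.Normal := by
  refine ⟨?_⟩
  rintro g ⟨-, u, hu, v, hv, huv, hvu, hg⟩ t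
  have hmem : ∀ t, ∀ x ∈ b.algebra, conjGroupAlgebra k N t x ∈ b.algebra := by
    intro t x hx
    rw [mem_algebra_iff] at hx ⊢
    nth_rewrite 1 [← hb t]
    rw [← map_mul, hx]
  refine ⟨hb _, _, hmem t u hu, _, hmem t v hv, ?_, ?_, fun x hx => ?_⟩
  · rw [← map_mul, huv, hb]
  · rw [← map_mul, hvu, hb]
  · rw [conjGroupAlgebra_mul, conjGroupAlgebra_mul, hg _ (hmem _ x hx), map_mul, map_mul,
      ← conjGroupAlgebra_mul k N t t⁻¹, mul_inv_cancel, conjGroupAlgebra_one]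

/-- A homogeneous element `y` of degree `gN` in the centralizer of the stable block `b` is
nilpotent unless `g` acts on `b` as an inner automorphism. Some power of `y` lies in the local
algebra `Z(b)`; if that power is not nilpotent, then `y` is invertible and `y g⁻¹` is a unit of `b`
whose inverse induces the action of `g`. -/
theorem IsStable.isNilpotent_of_isHomogeneousAt [Finite G] (hb : b.IsStable) {g : G}
    (hg : g ∉ b.innerSubgroup) {y : MonoidAlgebra k G} (hy : IsHomogeneousAt N (g : G ⧸ N) y)
    (hyN : ∀ n ∈ N, conjAlg k n y = y)
    (hyb : y * MonoidAlgebra.mapDomainAlgHom k k N.subtype b.idem = y) : IsNilpotent y := by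
  set ι := MonoidAlgebra.mapDomainAlgHom k k N.subtype with hι
  have hE := Subalgebra.mem_center_iff.1 hb.mapDomain_idem_mem_center
  have hcomm : ∀ s, Commute (ι s) y := commute_mapDomainAlgHom_subtype hyN
  have hn : 0 < orderOf (g : G ⧸ N) := orderOf_pos _
  obtain ⟨n, hn⟩ : ∃ n, orderOf (g : G ⧸ N) = n + 1 := ⟨_, (Nat.succ_pred_eq_of_pos hn).symm⟩
  obtain ⟨c, hc⟩ : ∃ c, ι c = y ^ (n + 1) := by
    refine IsHomogeneousAt.exists_eq ?_
    rw [← pow_orderOf_eq_one (g : G ⧸ N), hn]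
    exact hy.pow _
  have hcc : c ∈ Subalgebra.center k (MonoidAlgebra k N) := by
    rw [Subalgebra.mem_center_iff]
    intro s
    refine mapDomainAlgHom_subtype_injective ?_
    rw [map_mul, map_mul, ← hι, hc]
    exact (hcomm s).pow_right _
  have hcb : c * b.idem = c := by
    refine mapDomainAlgHom_subtype_injective ?_
    rw [map_mul, ← hι, hc, pow_succ, mul_assoc, hyb]
  rcases b.isNilpotent_or_exists_mul_eq_idem hcc with h | ⟨d, -, hcd, hdb⟩
  · rw [hcb] at h
    have h1 := h.map ι
    rw [hc] at h1
    exact IsNilpotent.of_pow h1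
  · exfalso
    refine hg ?_
    -- `w` is the inverse of `y` in the centralizer of `b`, and it has degree `g⁻¹N`
    set w := y ^ n * ι d with hw
    have hyw : y * w = ι b.idem := by
      rw [hw, ← mul_assoc, ← pow_succ', ← hc, ← map_mul, hcd]
    have hwy : w * y = ι b.idem := by
      rw [hw, mul_assoc, (hcomm d).eq, ← mul_assoc, ← pow_succ, ← hc, ← map_mul, hcd]
    have hwb : w * ι b.idem = w := by rw [hw, mul_assoc, ← map_mul, hdb]
    have hgg : MonoidAlgebra.of k G g⁻¹ * MonoidAlgebra.of k G g = 1 := by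
      rw [← map_mul, inv_mul_cancel, map_one]
    obtain ⟨s, hs⟩ : ∃ s, ι s = y * MonoidAlgebra.of k G g⁻¹ := by
      refine IsHomogeneousAt.exists_eq ?_
      have h := hy.mul (isHomogeneousAt_of (k := k) (N := N) g⁻¹)
      rwa [← QuotientGroup.mk_mul, mul_inv_cancel, QuotientGroup.mk_one] at h
    obtain ⟨t, ht⟩ : ∃ t, ι t = MonoidAlgebra.of k G g * w := by
      refine IsHomogeneousAt.exists_eq ?_
      have h := (isHomogeneousAt_of (k := k) (N := N) g).mul
        ((hy.pow n).mul (isHomogeneousAt_one_of_mapDomain d))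
      rwa [mul_one, ← pow_succ', ← hn, pow_orderOf_eq_one] at h
    refine ⟨hb g, t, ?_, s, ?_, ?_, ?_, fun x hx => ?_⟩
    · rw [mem_algebra_iff]
      refine mapDomainAlgHom_subtype_injective ?_
      rw [map_mul, ← hι, ht, mul_assoc, hwb]
    · rw [mem_algebra_iff]
      refine mapDomainAlgHom_subtype_injective ?_
      rw [map_mul, ← hι, hs, mul_assoc, hE, ← mul_assoc, hyb]
    · refine mapDomainAlgHom_subtype_injective ?_
      rw [map_mul, ← hι, hs, ht]
      calc MonoidAlgebra.of k G g * w * (y * MonoidAlgebra.of k G g⁻¹)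
          = MonoidAlgebra.of k G g * (w * y) * MonoidAlgebra.of k G g⁻¹ := by
            simp only [mul_assoc]
        _ = ι b.idem := by
          rw [hwy, ← conjAlg_apply, hι, ← mapDomainAlgHom_conjGroupAlgebra, hb g]
    · refine mapDomainAlgHom_subtype_injective ?_
      rw [map_mul, ← hι, hs, ht]
      calc y * MonoidAlgebra.of k G g⁻¹ * (MonoidAlgebra.of k G g * w)
          = y * (MonoidAlgebra.of k G g⁻¹ * MonoidAlgebra.of k G g) * w := by
            simp only [mul_assoc]
        _ = ι b.idem := by rw [hgg, mul_one, hyw]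
    · refine mapDomainAlgHom_subtype_injective ?_
      rw [mem_algebra_iff, b.mul_idem_comm] at hx
      rw [mapDomainAlgHom_conjGroupAlgebra, map_mul, map_mul, ← hι, hs, ht, conjAlg_apply]
      calc MonoidAlgebra.of k G g * ι x * MonoidAlgebra.of k G g⁻¹
          = MonoidAlgebra.of k G g * (w * y * ι x) * MonoidAlgebra.of k G g⁻¹ := by
            rw [hwy, ← map_mul, hx]
        _ = MonoidAlgebra.of k G g * w * (y * ι x) * MonoidAlgebra.of k G g⁻¹ := by
            simp only [mul_assoc]
        _ = MonoidAlgebra.of k G g * w * ι x * (y * MonoidAlgebra.of k G g⁻¹) := by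
            rw [← (hcomm x).eq]
            simp only [mul_assoc]

/-- A central element `z` of `kG` supported outside `G[b]` acts nilpotently on the stable block `b`.
The homogeneous components `y_q` of `z e_b` are nilpotent and satisfy `y_q y_r = y_{qrq⁻¹} y_q`. -/
theorem IsStable.isNilpotent_mul_idem [Finite G] (hb : b.IsStable) {z : MonoidAlgebra k G}
    (hz : z ∈ Subalgebra.center k (MonoidAlgebra k G))
    (hzb : ∀ g ∈ b.innerSubgroup, z.coeff g = 0) :
    IsNilpotent (z * MonoidAlgebra.mapDomainAlgHom k k N.subtype b.idem) := by
  have := Fintype.ofFinite (G ⧸ N)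
  have hEc := hb.mapDomain_idem_mem_center
  have hEE : MonoidAlgebra.mapDomainAlgHom k k N.subtype b.idem *
      MonoidAlgebra.mapDomainAlgHom k k N.subtype b.idem =
        MonoidAlgebra.mapDomainAlgHom k k N.subtype b.idem := by
    rw [← map_mul, b.isIdempotent.eq]
  have hEh := isHomogeneousAt_one_of_mapDomain (G := G) b.idem
  set E := MonoidAlgebra.mapDomainAlgHom k k N.subtype b.idem with hE
  let z' : G ⧸ N → MonoidAlgebra k G := fun q => restrictSupport k {g : G | (g : G ⧸ N) = q} z
  have hsum : z = ∑ q, z' q := by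
    ext g
    simp only [MonoidAlgebra.coeff_sum, Finsupp.coe_finsetSum, Finset.sum_apply]
    rw [Finset.sum_eq_single_of_mem (g : G ⧸ N) (Finset.mem_univ _)
      (fun q _ hq => coeff_restrictSupport_of_notMem (fun h => hq h.symm) z)]
    exact (coeff_restrictSupport_of_mem (S := {h : G | (h : G ⧸ N) = g}) (by simp) z).symm
  have hconj : ∀ (g : G) (q : G ⧸ N),
      conjAlg k g (z' q * E) = z' (g * q * (g : G ⧸ N)⁻¹) * E := by
    intro g q
    rw [map_mul, mem_center_iff_conjAlg.1 hEc, conjAlg_restrictSupport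
      (T := {h : G | (h : G ⧸ N) = g * q * (g : G ⧸ N)⁻¹}), mem_center_iff_conjAlg.1 hz]
    intro h
    simp only [Set.mem_ofPred_eq, QuotientGroup.mk_mul, QuotientGroup.mk_inv]
    rw [eq_mul_inv_iff_mul_eq, ← inv_mul_eq_iff_eq_mul, mul_assoc]
  have hN : ∀ q, ∀ n ∈ N, conjAlg k n (z' q * E) = z' q * E := by
    intro q n hn
    rw [hconj, (QuotientGroup.eq_one_iff n).2 hn, inv_one, one_mul, mul_one]
  rw [hsum, Finset.sum_mul]
  refine isNilpotent_sum_of_quandle_relation (fun q => z' q * E) (fun q => ?_) (fun q r => ?_)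
  · by_cases h0 : z' q = 0
    · simp only [h0, zero_mul]
      exact IsNilpotent.zero
    obtain ⟨g, hg⟩ : ∃ g, (z' q).coeff g ≠ 0 := by
      by_contra! h
      exact h0 (by ext g; simpa using h g)
    have hgq : g ∈ {g : G | (g : G ⧸ N) = q} := by
      by_contra h
      exact hg (coeff_restrictSupport_of_notMem h z)
    rw [coeff_restrictSupport_of_mem hgq] at hg
    refine hb.isNilpotent_of_isHomogeneousAt (mt (hzb g) hg) ?_ (hN q) (by rw [mul_assoc, hEE])
    have h1 := (isHomogeneousAt_restrictSupport q z).mul hEh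
    rw [mul_one] at h1
    rwa [hgq]
  · obtain ⟨s, g, rfl, hs⟩ := isHomogeneousAt_restrictSupport q z
    refine ⟨(g : G ⧸ N) * r * (g : G ⧸ N)⁻¹, ?_⟩
    have h1 : z' g * (z' r * E) =
        z' ((g : G ⧸ N) * r * (g : G ⧸ N)⁻¹) * E * z' g := by
      change restrictSupport k {h : G | (h : G ⧸ N) = g} z * _ =
        _ * restrictSupport k {h : G | (h : G ⧸ N) = g} z
      rw [hs, mul_assoc, of_mul_eq_conjAlg_mul, hconj, ← mul_assoc,
        (commute_mapDomainAlgHom_subtype (hN _) s).eq, mul_assoc]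
    calc z' g * E * (z' r * E) = z' g * (z' r * E) * E := by
          rw [Subalgebra.mem_center_iff.1 hEc (z' g * (z' r * E)), ← mul_assoc E,
            ← Subalgebra.mem_center_iff.1 hEc (z' g)]
      _ = _ := by rw [h1, mul_assoc]

end GroupBlock

/-! ### Abelian defect groups -/

/-- In characteristic `p`, the elements `1 - d` with `d` in an abelian `p`-group `D` are nilpotent
and commute with each other, so the ideal of `kC_G(D)` which they generate is nilpotent. -/
theorem isNilpotent_restrictSupport_relativeTrace_sub {p : ℕ} [Fact p.Prime] {k G : Type*}
    [Field k] [CharP k p] [Group G] [Finite G] {D : Subgroup G} (hD : IsPGroup p D)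
    (hab : ∀ x ∈ D, ∀ y ∈ D, x * y = y * x) {x : G} (hx : x ∈ D) {a : MonoidAlgebra k G}
    (ha : ∀ d ∈ D, conjAlg k d a = a) :
    IsNilpotent (restrictSupport k (Subgroup.centralizer (D : Set G) : Set G)
      (relativeTrace k D (a - MonoidAlgebra.of k G x * a))) := by
  classical
  have := Fintype.ofFinite (G ⧸ D)
  have hxa : ∀ d ∈ D, conjAlg k d (MonoidAlgebra.of k G x * a) = MonoidAlgebra.of k G x * a := by
    intro d hd
    rw [map_mul, ha d hd, conjAlg_of, hab d hd x hx, mul_inv_cancel_right]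
  have hxC : x ∈ Subgroup.centralizer (D : Set G) :=
    Subgroup.mem_centralizer_iff.2 fun d hd => hab d hd x hx
  have hxn : ∀ q : G ⧸ D, q.out ∈ Subgroup.normalizer (D : Set G) →
      q.out * x * q.out⁻¹ ∈ D := fun q hq => (Subgroup.mem_normalizer_iff.1 hq x).1 hx
  rw [restrictSupport_centralizer_relativeTrace hD
    (fun d hd => by rw [map_sub, ha d hd, hxa d hd])]
  have hterm : ∀ q ∈ ({q | q.out ∈ Subgroup.normalizer (D : Set G)} : Finset (G ⧸ D)),
      conjAlg k q.out (restrictSupport k (Subgroup.centralizer (D : Set G) : Set G)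
        (a - MonoidAlgebra.of k G x * a)) =
      (1 - MonoidAlgebra.of k G (q.out * x * q.out⁻¹)) *
        restrictSupport k (Subgroup.centralizer (D : Set G) : Set G) (conjAlg k q.out a) := by
    intro q hq
    have hq := inv_mul_mul_mem_centralizer_iff (Finset.mem_filter.1 hq).2
    rw [map_sub, ← of_mul_restrictSupport
      (fun h => Subgroup.mul_mem_cancel_left _ (inv_mem hxC)), map_sub, map_mul, conjAlg_of,
      conjAlg_restrictSupport hq, sub_mul, one_mul]
  rw [Finset.sum_congr rfl hterm]
  refine isNilpotent_sum_commuting_mul _ _ _ (fun q hq => ?_) (fun q hq r hr => ?_)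
    (fun q hq r _ => ?_)
  · obtain ⟨n, hn⟩ := hD ⟨_, hxn q (Finset.mem_filter.1 hq).2⟩
    have : CharP (MonoidAlgebra k G) p := charP_of_injective_algebraMap' k p
    refine ⟨p ^ n, ?_⟩
    rw [sub_pow_char_pow_of_commute _ _ (Commute.one_left _), one_pow, ← map_pow,
      show (q.out * x * q.out⁻¹) ^ p ^ n = 1 from congrArg Subtype.val hn, map_one, sub_self]
  · have h : Commute (q.out * x * q.out⁻¹) (r.out * x * r.out⁻¹) :=
      hab _ (hxn q (Finset.mem_filter.1 hq).2) _ (hxn r (Finset.mem_filter.1 hr).2)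
    exact (Commute.one_left _).sub_left ((Commute.one_right _).sub_right
      (h.map (MonoidAlgebra.of k G)))
  · exact (Commute.one_left _).sub_left
      (commute_of_restrictSupport_centralizer (hxn q (Finset.mem_filter.1 hq).2) _)

/-- A stable block idempotent of `kN` is central in `kG`, so by primitivity its product with `e_B` is
`0` or `e_B`. -/
theorem GroupBlock.Covers.idem_mul_eq {k G : Type*} [Field k] [Group G] {N : Subgroup G}
    [N.Normal] {B : GroupBlock k G} {b : GroupBlock k N} (hcov : B.Covers b) (hb : b.IsStable) :
    B.idem * MonoidAlgebra.mapDomainAlgHom k k N.subtype b.idem = B.idem := by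
  have hE := hb.mapDomain_idem_mem_center
  have hi : IsIdempotentElem (B.idem * MonoidAlgebra.mapDomainAlgHom k k N.subtype b.idem) := by
    refine B.isIdempotent.mul_of_commute (B.mul_idem_comm _).symm ?_
    rw [IsIdempotentElem, ← map_mul, b.isIdempotent.eq]
  refine (B.idem_eq_or_zero_of_mul_eq (mul_mem B.central hE) hi ?_).resolve_left hcov
  rw [B.mul_idem_comm, ← mul_assoc, B.isIdempotent.eq]

theorem mainTheorem4 {p : ℕ} [Fact p.Prime] {k : Type*} [Field k] [IsAlgClosed k] [CharP k p]
    {G : Type*} [Group G] [Finite G] (B : GroupBlock k G) (D : Subgroup G)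
    (hD : B.IsDefectGroup D) (hab : ∀ x ∈ D, ∀ y ∈ D, x * y = y * x)
    (N : Subgroup G) [N.Normal] (b : GroupBlock k N) (hb : b.IsStable) (hcov : B.Covers b) :
    D ≤ b.innerSubgroup := by
  intro x hx
  by_contra hxb
  have := Fintype.ofFinite (G ⧸ D)
  have hp : IsPGroup p D := hD.isPGroup
  have hH := hb.normal_innerSubgroup
  obtain ⟨a, ha, haB⟩ := hD.exists_relativeTrace
  have hEc := hb.mapDomain_idem_mem_center
  have hBE := hcov.idem_mul_eq hb
  have hnilp := fun z hz hzb => hb.isNilpotent_mul_idem (z := z) hz hzb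
  set E := MonoidAlgebra.mapDomainAlgHom k k N.subtype b.idem
  have hHconj : ∀ g h, g⁻¹ * h * g ∈ (b.innerSubgroup : Set G) ↔ h ∈ (b.innerSubgroup : Set G) :=
    fun g h => by simpa using (hH.mem_comm_iff (a := g⁻¹ * h) (b := g))
  -- the component of `a` in `k[G[b]]`; its relative trace is the component of `e_B`, as `G[b]` is normal
  set a₀ := restrictSupport k (b.innerSubgroup : Set G) a with ha₀
  have ha₀D : ∀ d ∈ D, conjAlg k d a₀ = a₀ := fun d hd => by
    rw [ha₀, conjAlg_restrictSupport (hHconj d), ha d hd]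
  -- here `D` is used to be abelian: multiplication by `x` preserves the `D`-fixed elements
  have hxaD : ∀ d ∈ D, conjAlg k d (MonoidAlgebra.of k G x * a₀) = MonoidAlgebra.of k G x * a₀ := by
    intro d hd
    rw [map_mul, ha₀D d hd, conjAlg_of, hab d hd x hx, mul_inv_cancel_right]
  have he₀ : relativeTrace k D a₀ = restrictSupport k (b.innerSubgroup : Set G) B.idem := by
    rw [← haB, relativeTrace_eq_sum, relativeTrace_eq_sum, map_sum]
    exact Finset.sum_congr rfl fun q _ => conjAlg_restrictSupport (hHconj _) a
  set e₀ := relativeTrace k D a₀ with he₀'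
  have he₀c : e₀ ∈ Subalgebra.center k (MonoidAlgebra k G) := relativeTrace_mem_center ha₀D
  -- both `e_B - e₀` and `z` are supported outside `G[b]`
  set z := relativeTrace k D (MonoidAlgebra.of k G x * a₀) with hz
  have hzc : z ∈ Subalgebra.center k (MonoidAlgebra k G) := relativeTrace_mem_center hxaD
  have hn₁ : IsNilpotent ((B.idem - e₀) * E) := by
    refine hnilp _ (sub_mem B.central he₀c) fun g hg => ?_
    rw [he₀, MonoidAlgebra.coeff_sub, Finsupp.sub_apply, coeff_restrictSupport_of_mem hg, sub_self]
  have hn₂ : IsNilpotent (z * E) := by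
    refine hnilp _ hzc fun g hg => ?_
    rw [hz, relativeTrace_eq_sum]
    simp only [MonoidAlgebra.coeff_sum, Finsupp.coe_finsetSum, Finset.sum_apply]
    refine Finset.sum_eq_zero fun q _ => ?_
    rw [coeff_conjAlg]
    have h1 : x⁻¹ * (q.out⁻¹ * g * q.out) ∉ (b.innerSubgroup : Set G) := fun h => by
      have h2 : q.out⁻¹ * g * q.out ∈ b.innerSubgroup := (hHconj _ _).2 hg
      exact hxb (inv_mem_iff.1 ((Subgroup.mul_mem_cancel_right _ h2).1 h))
    simp [ha₀, coeff_restrictSupport_of_notMem h1]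
  have hcomm : ∀ {u v : MonoidAlgebra k G}, u ∈ Subalgebra.center k (MonoidAlgebra k G) →
      Commute u v := fun hu => (Subalgebra.mem_center_iff.1 hu _).symm
  have hfix : ∀ {u : MonoidAlgebra k G}, u ∈ Subalgebra.center k (MonoidAlgebra k G) →
      ∀ d ∈ D, conjAlg k d u = u := fun hu d _ => mem_center_iff_conjAlg.1 hu d
  have hν : IsNilpotent ((B.idem - e₀) * E + z * E) :=
    (hcomm (mul_mem (sub_mem B.central he₀c) hEc)).isNilpotent_add hn₁ hn₂
  have hνc := add_mem (mul_mem (sub_mem B.central he₀c) hEc) (mul_mem hzc hEc)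
  have hsplit : B.idem = (e₀ - z) * E + ((B.idem - e₀) * E + z * E) := by
    have h : e₀ - z + (B.idem - e₀ + z) = B.idem := by abel
    rw [← add_mul, ← add_mul, h, hBE]
  set ν := (B.idem - e₀) * E + z * E
  have hwc := sub_mem he₀c hzc
  -- `e_B` is congruent, modulo nilpotent elements, to `(e₀ - z) E`, which the Brauer map makes
  -- nilpotent
  set Br := restrictSupport k (Subgroup.centralizer (D : Set G) : Set G) with hBr
  have hBw : IsNilpotent (Br (e₀ - z)) := by
    rw [he₀', hz, ← relativeTrace_sub]
    exact isNilpotent_restrictSupport_relativeTrace_sub hp hab hx ha₀D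
  have hBrcomm : ∀ {u v : MonoidAlgebra k G}, u ∈ Subalgebra.center k (MonoidAlgebra k G) →
      v ∈ Subalgebra.center k (MonoidAlgebra k G) → Commute (Br u) (Br v) := by
    intro u v hu hv
    rw [Commute, SemiconjBy, ← restrictSupport_centralizer_mul hp (hfix hu) (hfix hv),
      (hcomm hu).eq, restrictSupport_centralizer_mul hp (hfix hv) (hfix hu)]
  have hBν : IsNilpotent (Br ν) := by
    obtain ⟨n, hn⟩ := hν
    refine ⟨n + 1, ?_⟩
    rw [← restrictSupport_centralizer_pow hp hνc n.succ_ne_zero, pow_succ, hn, zero_mul, map_zero]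
  have hBe : IsNilpotent (Br B.idem) := by
    rw [hsplit, map_add]
    refine (hBrcomm (mul_mem hwc hEc) hνc).isNilpotent_add ?_ hBν
    rw [restrictSupport_centralizer_mul hp (hfix hwc) (hfix hEc)]
    exact (hBrcomm hwc hEc).isNilpotent_mul_right hBw
  refine hD.restrictSupport_idem_ne_zero (IsIdempotentElem.eq_zero_of_isNilpotent ?_ hBe)
  rw [IsIdempotentElem, ← restrictSupport_centralizer_mul hp (hfix B.central) (hfix B.central),
    B.isIdempotent.eq]
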